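/- Let $\mathbb K\in\{\mathbb R,\mathbb C\}$, let $\mathscr M=\{M_1,\dots,M_r\}$ be a finite family of $d\times d$ matrices over $\mathbb K$, let $\|\cdot\|$ be a sub-multiplicative norm on $\mathbb K^{d\times d}$, let $\ell\ge 1$ be an integer, and let $p_i>0$ with $\sum_{i=1}^r p_i=1$ and $0\le p_i^-<p_i<p_i^+\le 1$ for $i=1,\dots,r$. Let $\mathscr A=\{1,\dots,r\}$, and for a finite sequence $\alpha$ of symbols of $\mathscr A$ let $|\alpha|_i$ be the number of occurrences of $i$ in $\alpha$. Let $\mathscr A_\ell(p^\pm)$ be the set of all $\alpha\in\mathscr A^\ell$ with $p_i^-\le |\alpha|_i/\ell\le p_i^+$ for all $i$, and let $\mathscr A_\ell^{\mathbb N}(p^\pm)$ be the set of all infinite sequences $(\alpha_k)_{k\ge0}$ in $\mathscr A$ each of whose blocks of $\ell$ consecutive symbols belongs to $\mathscr A_\ell(p^\pm)$. A finite sequence of length $n\ge 1$ is called admissible if it is an initial interval of some sequence in $\mathscr A_\ell^{\mathbb N}(p^\pm)$, and periodically extendable if it is the initial interval of some $n$-periodic sequence in $\mathscr A_\ell^{\mathbb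 N}(p^\pm)$. For $n\ge1$ put $$\rho_n:=\sup\|M_{\alpha_n}\cdots M_{\alpha_1}\|^{1/n},\qquad \hat\rho_n:=\sup\rho(M_{\alpha_n}\cdots M_{\alpha_1})^{1/n},\qquad \hat\rho_n^{(\mathrm{per})}:=\sup\rho(M_{\alpha_n}\cdots M_{\alpha_1})^{1/n},$$ where $\rho(\cdot)$ of a matrix is its spectral radius (the largest modulus of its complex eigenvalues), the first two suprema are over all admissible sequences $(\alpha_1,\dots,\alpha_n)$, the third is over all periodically extendable admissible sequences $(\alpha_1,\dots,\alpha_n)$, and a supremum over the empty set is $0$. Define $$\rho(\mathscr M,\mathscr A_\ell(p^\pm)):=\limsup_{n\to\infty}\rho_n,\qquad \hat\rho(\mathscr M,\mathscr A_\ell(p^\pm)):=\limsup_{n\to\infty}\hat\rho_n,\qquad \hat\rho^{(\mathrm{per})}(\mathscr M,\mathscr A_\ell(p^\pm)):=\limsup_{n\to\infty}\hat\rho_n^{(\mathrm{per})}.$$ Then $\rho(\mathscr M,\mathscr A_\ell(p^\pm))$ is finite, and $$\hat\rho^{(\mathrm{per})}(\mathscr M,\mathscr A_\ell(p^\pm))=\rho(\mathscr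 M,\mathscr A_\ell(p^\pm)),$$ and consequently the Berger–Wang type equality $$\hat\rho(\mathscr M,\mathscr A_\ell(p^\pm))=\rho(\mathscr M,\mathscr A_\ell(p^\pm))$$ holds as well. -/

import Mathlib

open Filter
open scoped ENNReal

noncomputable section

namespace ConstrainedJSR

/-- The number of occurrences of the symbol `i` in the finite sequence `α`. -/
def occ {r n : ℕ} (α : Fin n → Fin r) (i : Fin r) : ℕ :=
  (Finset.univ.filter fun k => α k = i).card

/-- The sequences of length `l` in which the relative frequency of every symbol `i` lies
between `pm i` and `pp i`. -/
def blocks {r : ℕ} (l : ℕ) (pm pp : Fin r → ℝ) : Set (Fin l → Fin r) :=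
  {α | ∀ i, pm i ≤ (occ α i : ℝ) / (l : ℝ) ∧ (occ α i : ℝ) / (l : ℝ) ≤ pp i}

/-- The infinite sequences all of whose blocks of `l` consecutive symbols satisfy the frequency
constraints. -/
def seqs {r : ℕ} (l : ℕ) (pm pp : Fin r → ℝ) : Set (ℕ → Fin r) :=
  {β | ∀ m : ℕ, (fun k : Fin l => β (m + k)) ∈ blocks l pm pp}

/-- The admissible sequences of length `n`: the initial intervals of the sequences in `seqs`. -/
def admissible {r : ℕ} (l : ℕ) (pm pp : Fin r → ℝ) (n : ℕ) : Set (Fin n → Fin r) :=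
  {α | ∃ β ∈ seqs l pm pp, ∀ k : Fin n, β k = α k}

/-- The periodically extendable admissible sequences of length `n`: those which extend to the
right to an `n`-periodic sequence in `seqs`. -/
def perAdmissible {r : ℕ} (l : ℕ) (pm pp : Fin r → ℝ) (n : ℕ) : Set (Fin n → Fin r) :=
  {α | α ∈ admissible l pm pp n ∧
    ∃ β ∈ seqs l pm pp, Function.Periodic β n ∧ ∀ k : Fin n, β k = α k}

variable {𝕂 : Type*} [RCLike 𝕂] {d r : ℕ}

/-- The product `M (α (n-1)) * ⋯ * M (α 1) * M (α 0)`. -/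
def matProd (M : Fin r → Matrix (Fin d) (Fin d) 𝕂) {n : ℕ} (α : Fin n → Fin r) :
    Matrix (Fin d) (Fin d) 𝕂 :=
  (List.ofFn fun k => M (α k)).reverse.prod

/-- The spectral radius of a real or complex matrix: the largest modulus of its complex
eigenvalues (also if the matrix is real). -/
def specRad (A : Matrix (Fin d) (Fin d) 𝕂) : ℝ≥0∞ :=
  spectralRadius ℂ (A.map (RCLike.map 𝕂 ℂ))

/-- The supremum of `‖M_{α_n} ⋯ M_{α_1}‖ ^ (1/n)` over the admissible sequences of length `n`;
it is `0` if there are none. -/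
def jointRadN (N : AlgebraNorm 𝕂 (Matrix (Fin d) (Fin d) 𝕂))
    (M : Fin r → Matrix (Fin d) (Fin d) 𝕂) (l : ℕ) (pm pp : Fin r → ℝ) (n : ℕ) : ℝ≥0∞ :=
  ⨆ α ∈ admissible l pm pp n, ENNReal.ofReal (N (matProd M α)) ^ (1 / (n : ℝ))

/-- The constrained joint spectral radius. -/
def jointRad (N : AlgebraNorm 𝕂 (Matrix (Fin d) (Fin d) 𝕂))
    (M : Fin r → Matrix (Fin d) (Fin d) 𝕂) (l : ℕ) (pm pp : Fin r → ℝ) : ℝ≥0∞ :=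
  limsup (fun n : ℕ => jointRadN N M l pm pp n) atTop

/-- The supremum of `ρ(M_{α_n} ⋯ M_{α_1}) ^ (1/n)` over the admissible sequences of length `n`;
it is `0` if there are none. -/
def genRadN (M : Fin r → Matrix (Fin d) (Fin d) 𝕂) (l : ℕ) (pm pp : Fin r → ℝ) (n : ℕ) :
    ℝ≥0∞ :=
  ⨆ α ∈ admissible l pm pp n, specRad (matProd M α) ^ (1 / (n : ℝ))

/-- The constrained generalized spectral radius. -/
def genRad (M : Fin r → Matrix (Fin d) (Fin d) 𝕂) (l : ℕ) (pm pp : Fin r → ℝ) : ℝ≥0∞ :=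
  limsup (fun n : ℕ => genRadN M l pm pp n) atTop

/-- The supremum of `ρ(M_{α_n} ⋯ M_{α_1}) ^ (1/n)` over the periodically extendable admissible
sequences of length `n`; it is `0` if there are none. -/
def perRadN (M : Fin r → Matrix (Fin d) (Fin d) 𝕂) (l : ℕ) (pm pp : Fin r → ℝ) (n : ℕ) :
    ℝ≥0∞ :=
  ⨆ α ∈ perAdmissible l pm pp n, specRad (matProd M α) ^ (1 / (n : ℝ))

/-- The constrained periodic generalized spectral radius. -/
def perRad (M : Fin r → Matrix (Fin d) (Fin d) 𝕂) (l : ℕ) (pm pp : Fin r → ℝ) : ℝ≥0∞ :=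
  limsup (fun n : ℕ => perRadN M l pm pp n) atTop

end ConstrainedJSR

end

/-! The chain `perRad ≤ genRad ≤ jointRad ≤ perRad` gives both equalities. The first inequality is
inclusion of index sets; the second holds because the spectral radius is at most a constant times
any norm, and the constant disappears under `n`-th roots.

For the third, the constraint becomes a graph: vertices are the allowed blocks of length `l`, edges
join overlapping blocks, walks are constrained sequences and closed walks are periodic ones. Each
edge acts on `S → V` as a matrix of endomorphisms with a single nonzero block. A product of edges
vanishes unless the edges form a walk, and has a nonzero eigenvalue only if that walk closes up
(`eigenBound_edgeMap`). So the periodic spectral radii bound the eigenvalues of all products of edge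
maps, and the unconstrained Berger–Wang theorem (`hasNormRate_of_eigenBound`) bounds the norms along
all walks.

That theorem is proved by induction on dimension: Burnside's theorem and traces settle the
irreducible case; otherwise norms on an invariant subspace and its quotient are glued. -/

namespace ConstrainedJSR

/-- On a finite-dimensional space every seminorm is dominated by every norm. -/
theorem exists_seminorm_le_mul {𝕜 E : Type*} [RCLike 𝕜] [AddCommGroup E] [Module 𝕜 E]
    [FiniteDimensional 𝕜 E] (N Q : Seminorm 𝕜 E) (hN : ∀ x, N x = 0 → x = 0) :
    ∃ C, 0 < C ∧ ∀ x, Q x ≤ C * N x := by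
  let : Norm E := ⟨N⟩
  have core : NormedSpace.Core 𝕜 E :=
    { norm_nonneg := fun x => apply_nonneg N x
      norm_smul := fun c x => map_smul_eq_mul N c x
      norm_triangle := fun x y => map_add_le_add N x y
      norm_eq_zero_iff := fun x => ⟨hN x, fun h => by subst h; exact map_zero N⟩ }
  let : NormedAddCommGroup E := NormedAddCommGroup.ofCore core
  let : NormedSpace 𝕜 E := NormedSpace.ofCore core
  let b := Module.finBasis 𝕜 E
  have hcoord : ∀ i x, ‖b.repr x i‖ ≤ ‖LinearMap.toContinuousLinearMap (b.coord i)‖ * N x :=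
    fun i x => (LinearMap.toContinuousLinearMap (b.coord i)).le_opNorm x
  set C := ∑ i, ‖LinearMap.toContinuousLinearMap (b.coord i)‖ * Q (b i) with hC
  have hC0 : 0 ≤ C := Finset.sum_nonneg fun i _ => mul_nonneg (norm_nonneg _) (apply_nonneg Q _)
  refine ⟨C + 1, by linarith, fun x => ?_⟩
  calc Q x = Q (∑ i, b.repr x i • b i) := by rw [b.sum_repr]
    _ ≤ ∑ i, Q (b.repr x i • b i) :=
        Finset.le_sum_of_subadditive Q (map_zero Q).le (map_add_le_add Q) _ _
    _ ≤ ∑ i, ‖LinearMap.toContinuousLinearMap (b.coord i)‖ * Q (b i) * N x := by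
        refine Finset.sum_le_sum fun i _ => ?_
        rw [map_smul_eq_mul]
        nlinarith [mul_le_mul_of_nonneg_right (hcoord i x) (apply_nonneg Q (b i))]
    _ = C * N x := by rw [hC, Finset.sum_mul]
    _ ≤ (C + 1) * N x := by nlinarith [apply_nonneg N x]

/-! ### Berger–Wang for an unconstrained finite family. -/

section Family

variable {ι V : Type*} [AddCommGroup V] [Module ℂ V]

/-- There is a norm in which every member of the family `f` expands by at most the factor `c`. -/
def HasNormRate (f : ι → Module.End ℂ V) (c : ℝ) : Prop :=
  ∃ N : Seminorm ℂ V, (∀ v, N v = 0 → v = 0) ∧ ∀ i v, N (f i v) ≤ c * N v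

/-- The eigenvalues of every product of `n` members of the family `f` are at most `c ^ n` in
modulus. -/
def EigenBound (f : ι → Module.End ℂ V) (c : ℝ) : Prop :=
  ∀ (w : List ι) (z : ℂ), (w.map f).prod.HasEigenvalue z → ‖z‖ ≤ c ^ w.length

theorem EigenBound.restrict {f : ι → Module.End ℂ V} {c : ℝ} (hf : EigenBound f c)
    {W : Submodule ℂ V} (hW : ∀ i, ∀ v ∈ W, f i v ∈ W) :
    EigenBound (fun i => (f i).restrict (hW i)) c := by
  intro w z hz
  obtain ⟨v, hv⟩ := hz.exists_hasEigenvector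
  have key : ∀ x : W, (((w.map fun i => (f i).restrict (hW i)).prod x : W) : V) =
      (w.map f).prod x := by
    clear hz hv
    intro x
    induction w with
    | nil => simp
    | cons i w ih => simp [ih]
  refine hf w z (Module.End.hasEigenvalue_of_hasEigenvector (x := (v : V)) ?_)
  refine ⟨Module.End.mem_eigenspace_iff.2 ?_, fun h => hv.2 (Subtype.ext h)⟩
  rw [← key, hv.apply_eq_smul]
  rfl

theorem EigenBound.mapQ [FiniteDimensional ℂ V] {f : ι → Module.End ℂ V} {c : ℝ}
    (hf : EigenBound f c) {W : Submodule ℂ V} (hW : ∀ i, W ≤ W.comap (f i)) :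
    EigenBound (fun i => W.mapQ W (f i) (hW i)) c := by
  intro w z hz
  refine hf w z ?_
  have key : ∀ x : V, (w.map fun i => W.mapQ W (f i) (hW i)).prod (W.mkQ x) =
      W.mkQ ((w.map f).prod x) := by
    clear hz
    intro x
    induction w with
    | nil => simp
    | cons i w ih => simp at ih; simp [ih]
  rw [Module.End.hasEigenvalue_iff, Module.End.eigenspace_def] at hz ⊢
  -- If `T - z` is injective it is surjective on `V`, hence surjective on the quotient, hence
  -- injective there.
  contrapose! hz
  have hsurj := LinearMap.injective_iff_surjective.1 (LinearMap.ker_eq_bot.1 hz)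
  refine LinearMap.ker_eq_bot.2 (LinearMap.injective_iff_surjective.2 fun y => ?_)
  obtain ⟨y, rfl⟩ := W.mkQ_surjective y
  obtain ⟨x, rfl⟩ := hsurj y
  refine ⟨W.mkQ x, ?_⟩
  rw [LinearMap.sub_apply, key, LinearMap.sub_apply, map_sub]
  simp

theorem norm_trace_le_of_eigenBound [FiniteDimensional ℂ V] {f : ι → Module.End ℂ V} {c : ℝ}
    (hf : EigenBound f c) (w : List ι) :
    ‖LinearMap.trace ℂ V (w.map f).prod‖ ≤ Module.finrank ℂ V * c ^ w.length := by
  rw [Module.End.trace_eq_sum_roots_charpoly_of_splits (IsAlgClosed.splits _)]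
  refine (Multiset.le_sum_of_subadditive (fun z : ℂ => ‖z‖) norm_zero.le norm_add_le _).trans ?_
  have h := Multiset.sum_le_card_nsmul
    ((w.map f).prod.charpoly.roots.map fun z => ‖z‖) (c ^ w.length) (by
      intro x hx
      obtain ⟨z, hz, rfl⟩ := Multiset.mem_map.1 hx
      exact hf w z ((Module.End.hasEigenvalue_iff_isRoot_charpoly _ _).2
        (Polynomial.isRoot_of_mem_roots hz)))
  rw [Multiset.card_map, IsAlgClosed.card_roots_eq_natDegree, LinearMap.charpoly_natDegree,
    nsmul_eq_mul] at h
  exact h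

/-- Burnside's theorem: the products of an irreducible family span all endomorphisms. -/
theorem span_list_prod_eq_top [FiniteDimensional ℂ V] [Nontrivial V] (f : ι → Module.End ℂ V)
    (hf : ∀ W : Submodule ℂ V, (∀ i, ∀ v ∈ W, f i v ∈ W) → W = ⊥ ∨ W = ⊤) :
    Submodule.span ℂ (Set.range fun w : List ι => (w.map f).prod) = ⊤ := by
  let A := Algebra.adjoin ℂ (Set.range f)
  have hsimple : IsSimpleModule A V := by
    rw [isSimpleModule_iff]
    refine { exists_pair_ne := ⟨⊥, ⊤, bot_ne_top⟩, eq_bot_or_eq_top := fun U => ?_ }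
    rcases hf (U.restrictScalars ℂ) (fun i v hv =>
      U.smul_mem (⟨f i, Algebra.subset_adjoin ⟨i, rfl⟩⟩ : A) hv) with h | h
    · left; exact (Submodule.restrictScalars_eq_bot_iff ℂ A V).1 h
    · right; exact (Submodule.restrictScalars_eq_top_iff ℂ A V).1 h
  have hbij := IsSimpleModule.algebraMap_end_bijective_of_isAlgClosed (A := A) (V := V) ℂ
  rw [eq_top_iff]
  intro T _
  obtain ⟨s, hs⟩ := Module.Finite.fg_top (R := ℂ) (M := V)
  -- By Schur's lemma the `A`-endomorphisms of `V` are scalars, so every `T` commutes with them and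
  -- the density theorem applies.
  let T' : Module.End (Module.End A V) V :=
    { toFun := T
      map_add' := map_add T
      map_smul' := fun g v => by
        obtain ⟨z, rfl⟩ := hbij.2 g
        simp }
  obtain ⟨a, ha⟩ := jacobson_density T' s
  have hTa : T = (a : Module.End ℂ V) :=
    LinearMap.ext_on hs fun m hm => ha m hm
  have hmem : (a : Module.End ℂ V) ∈ Subalgebra.toSubmodule A := a.2
  rw [Algebra.adjoin_eq_span] at hmem
  rw [hTa]
  refine Submodule.span_mono ?_ hmem
  intro x hx
  induction hx using Submonoid.closure_induction with
  | mem x hx => obtain ⟨i, rfl⟩ := hx; exact ⟨[i], by simp⟩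
  | one => exact ⟨[], by simp⟩
  | mul x y _ _ hx hy =>
    obtain ⟨u, rfl⟩ := hx
    obtain ⟨v, rfl⟩ := hy
    exact ⟨u ++ v, by simp⟩

/-- Traces of words `w` are `O(c ^ |w|)`. Since words span all endomorphisms, so are the traces of
`w * T` for each fixed `T`; rank-one `T` turns this into a bound on `φ (w v)`. The norm is the
supremum of `‖φ (w v)‖ / c ^ |w|` over words. -/
theorem HasNormRate.of_irreducible [FiniteDimensional ℂ V] [Nontrivial V]
    {f : ι → Module.End ℂ V} {c : ℝ} (hc : 0 < c) (hb : EigenBound f c)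
    (hf : ∀ W : Submodule ℂ V, (∀ i, ∀ v ∈ W, f i v ∈ W) → W = ⊥ ∨ W = ⊤) :
    HasNormRate f c := by
  obtain ⟨v₀, hv₀⟩ := exists_ne (0 : V)
  obtain ⟨φ, hφ⟩ := Module.Projective.exists_dual_ne_zero ℂ hv₀
  have htr : ∀ T : Module.End ℂ V, ∃ K, ∀ w : List ι,
      ‖LinearMap.trace ℂ V ((w.map f).prod * T)‖ ≤ K * c ^ w.length := by
    intro T
    have hT : T ∈ Submodule.span ℂ (Set.range fun w : List ι => (w.map f).prod) := by
      rw [span_list_prod_eq_top f hf]; trivial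
    induction hT using Submodule.span_induction with
    | mem T hT =>
      obtain ⟨u, rfl⟩ := hT
      refine ⟨Module.finrank ℂ V * c ^ u.length, fun w => ?_⟩
      have := norm_trace_le_of_eigenBound hb (w ++ u)
      rw [List.map_append, List.prod_append, List.length_append, pow_add] at this
      linarith
    | zero => exact ⟨0, by simp⟩
    | add S T _ _ hS hT =>
      obtain ⟨K, hK⟩ := hS
      obtain ⟨L, hL⟩ := hT
      refine ⟨K + L, fun w => ?_⟩
      rw [mul_add, map_add, add_mul]
      exact (norm_add_le _ _).trans (add_le_add (hK w) (hL w))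
    | smul z T _ hT =>
      obtain ⟨K, hK⟩ := hT
      refine ⟨‖z‖ * K, fun w => ?_⟩
      rw [mul_smul_comm, map_smul, smul_eq_mul, norm_mul, mul_assoc]
      exact mul_le_mul_of_nonneg_left (hK w) (norm_nonneg z)
  have hbdd : ∀ v, BddAbove (Set.range fun w : List ι =>
      ‖φ ((w.map f).prod v)‖ / c ^ w.length) := by
    intro v
    obtain ⟨K, hK⟩ := htr (φ.smulRight v)
    refine ⟨K, ?_⟩
    rintro _ ⟨w, rfl⟩
    have h : (w.map f).prod * φ.smulRight v = φ.smulRight ((w.map f).prod v) := by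
      ext x; simp
    have := hK w
    rw [h, LinearMap.trace_smulRight] at this
    exact (div_le_iff₀ (pow_pos hc _)).2 this
  have hle : ∀ v (w : List ι), ‖φ ((w.map f).prod v)‖ / c ^ w.length ≤
      ⨆ w : List ι, ‖φ ((w.map f).prod v)‖ / c ^ w.length := fun v w => le_ciSup (hbdd v) w
  let N : Seminorm ℂ V := Seminorm.of
    (fun v => ⨆ w : List ι, ‖φ ((w.map f).prod v)‖ / c ^ w.length)
    (fun x y => ciSup_le fun w => by
      refine le_trans ?_ (add_le_add (hle x w) (hle y w))
      rw [map_add, map_add, ← add_div]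
      exact div_le_div_of_nonneg_right (norm_add_le _ _) (pow_pos hc _).le)
    (fun z x => by
      rw [Real.mul_iSup_of_nonneg (norm_nonneg z)]
      simp only [map_smul, smul_eq_mul, norm_mul, mul_div_assoc])
  have hNdef : ∀ v, N v = ⨆ w : List ι, ‖φ ((w.map f).prod v)‖ / c ^ w.length := fun v => rfl
  have hrate : ∀ i v, N (f i v) ≤ c * N v := by
    intro i v
    rw [hNdef, hNdef]
    refine ciSup_le fun w => ?_
    have := hle v (w ++ [i])
    rw [List.map_append, List.prod_append, List.length_append] at this
    simp only [List.map_cons, List.map_nil, List.prod_singleton, Module.End.mul_apply,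
      List.length_singleton, pow_succ] at this
    rw [div_le_iff₀ (by positivity)] at this ⊢
    linarith
  refine ⟨N, fun v hv => ?_, hrate⟩
  -- The null space of `N` is invariant, and it is proper because the empty word gives `N v₀ ≥ ‖φ
  -- v₀‖ > 0`.
  let W : Submodule ℂ V :=
    { carrier := {v | N v = 0}
      zero_mem' := map_zero N
      add_mem' := fun {x y} hx hy => le_antisymm
        ((map_add_le_add N x y).trans (by
          rw [show N x = 0 from hx, show N y = 0 from hy, add_zero]))
        (apply_nonneg N _)
      smul_mem' := fun z x hx => (map_smul_eq_mul N z x).trans (by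
        rw [show N x = 0 from hx, mul_zero]) }
  have hW : ∀ i, ∀ v ∈ W, f i v ∈ W := fun i v hv =>
    le_antisymm ((hrate i v).trans (by rw [show N v = 0 from hv, mul_zero])) (apply_nonneg N _)
  rcases hf W hW with h | h
  · exact (Submodule.mem_bot ℂ).1 (h ▸ (show v ∈ W from hv))
  · exfalso
    have h0 : N v₀ = 0 := show v₀ ∈ W from h ▸ Submodule.mem_top
    have := hle v₀ []
    rw [← hNdef, h0] at this
    simp at this
    exact hφ this

/-- In a splitting `V = W ⊕ V/W` the family is block triangular. Weighting the `W` part by a small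
`ε` makes the off-diagonal blocks cost at most `c' - c`. -/
theorem HasNormRate.of_invariant [Finite ι] [FiniteDimensional ℂ V] {f : ι → Module.End ℂ V}
    {c c' : ℝ} (hcc' : c < c') {W : Submodule ℂ V} (hW : ∀ i, ∀ v ∈ W, f i v ∈ W)
    (hsub : HasNormRate (fun i => (f i).restrict (hW i)) c)
    (hquot : HasNormRate (fun i => W.mapQ W (f i) (hW i)) c) : HasNormRate f c' := by
  have := Fintype.ofFinite ι
  obtain ⟨P, hP, hPf⟩ := hsub
  obtain ⟨Q, hQ, hQf⟩ := hquot
  obtain ⟨π, hπ⟩ := LinearMap.exists_leftInverse_of_injective W.subtype W.ker_subtype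
  have hπ' : ∀ x : W, π x = x := fun x => LinearMap.congr_fun hπ x
  -- The off-diagonal block; it descends to the quotient because `id - π` kills `W`.
  let L : ι → (V ⧸ W) →ₗ[ℂ] W := fun i =>
    W.liftQ (π ∘ₗ f i ∘ₗ (LinearMap.id - W.subtype ∘ₗ π)) (fun x hx => by
      have : π x = ⟨x, hx⟩ := hπ' ⟨x, hx⟩
      simp [this])
  choose K hK0 hK using fun i => exists_seminorm_le_mul Q (P.comp (L i)) hQ
  obtain ⟨ε, hε, hεK⟩ : ∃ ε : ℝ, 0 < ε ∧ ε * ∑ i, K i ≤ c' - c := by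
    have hS : 0 ≤ ∑ i, K i := Finset.sum_nonneg fun i _ => (hK0 i).le
    have hδ : 0 < c' - c := sub_pos.2 hcc'
    refine ⟨(c' - c) / (∑ i, K i + 1), by positivity, ?_⟩
    rw [div_mul_eq_mul_div, div_le_iff₀ (by positivity)]
    nlinarith
  have hsplit : ∀ i v, π (f i v) = (f i).restrict (hW i) (π v) + L i (W.mkQ v) := by
    intro i v
    have h := hπ' ((f i).restrict (hW i) (π v))
    rw [LinearMap.coe_restrict_apply] at h
    simp [L, h]
  let N : Seminorm ℂ V := ε.toNNReal • P.comp π + Q.comp W.mkQ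
  have hN : ∀ v, N v = ε * P (π v) + Q (W.mkQ v) := fun v => by
    change (ε.toNNReal : ℝ) * P (π v) + Q (W.mkQ v) = _
    rw [Real.coe_toNNReal ε hε.le]
  refine ⟨N, fun v hv => ?_, fun i v => ?_⟩
  · rw [hN] at hv
    have h1 : 0 ≤ ε * P (π v) := mul_nonneg hε.le (apply_nonneg P _)
    have h2 : 0 ≤ Q (W.mkQ v) := apply_nonneg Q _
    have hQv : Q (W.mkQ v) = 0 := by linarith
    have hvW : v ∈ W := (Submodule.Quotient.mk_eq_zero W).1 (hQ _ hQv)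
    have hPv : P (π v) = 0 := by
      have : ε * P (π v) = 0 := by linarith
      exact (mul_eq_zero.1 this).resolve_left hε.ne'
    have := hP _ hPv
    rw [hπ' ⟨v, hvW⟩] at this
    exact congrArg Subtype.val this
  · rw [hN, hN, hsplit]
    have h1 := map_add_le_add P ((f i).restrict (hW i) (π v)) (L i (W.mkQ v))
    have h2 := hPf i (π v)
    have h3 : P (L i (W.mkQ v)) ≤ K i * Q (W.mkQ v) := hK i (W.mkQ v)
    have h4 : Q (W.mkQ (f i v)) ≤ c * Q (W.mkQ v) := hQf i (W.mkQ v)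
    have h5 : K i ≤ ∑ i, K i :=
      Finset.single_le_sum (f := K) (fun i _ => (hK0 i).le) (Finset.mem_univ i)
    have hp : 0 ≤ P (π v) := apply_nonneg P _
    have hq : 0 ≤ Q (W.mkQ v) := apply_nonneg Q _
    have h6 : ε * K i ≤ c' - c := (mul_le_mul_of_nonneg_left h5 hε.le).trans hεK
    calc ε * P ((f i).restrict (hW i) (π v) + L i (W.mkQ v)) + Q (W.mkQ (f i v))
        ≤ ε * (c * P (π v) + K i * Q (W.mkQ v)) + c * Q (W.mkQ v) := by
          gcongr
          exact h1.trans (add_le_add h2 h3)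
      _ = c * (ε * P (π v)) + (ε * K i) * Q (W.mkQ v) + c * Q (W.mkQ v) := by ring
      _ ≤ c' * (ε * P (π v)) + (c' - c) * Q (W.mkQ v) + c * Q (W.mkQ v) := by
          gcongr
      _ = c' * (ε * P (π v) + Q (W.mkQ v)) := by ring

/-- The Berger–Wang theorem for a finite family of endomorphisms of a finite-dimensional complex
vector space. -/
theorem hasNormRate_of_eigenBound [Finite ι] [FiniteDimensional ℂ V] {f : ι → Module.End ℂ V}
    {c c' : ℝ} (hc : 0 < c) (hcc' : c < c') (hf : EigenBound f c) : HasNormRate f c' := by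
  induction hn : Module.finrank ℂ V using Nat.strong_induction_on generalizing V c' with
  | _ n ih =>
    rcases subsingleton_or_nontrivial V with hV | hV
    · exact ⟨0, fun v _ => Subsingleton.elim _ _, fun i v => by simp⟩
    by_cases hirr : ∀ W : Submodule ℂ V, (∀ i, ∀ v ∈ W, f i v ∈ W) → W = ⊥ ∨ W = ⊤
    · obtain ⟨N, hN, hNf⟩ := HasNormRate.of_irreducible hc hf hirr
      exact ⟨N, hN, fun i v => (hNf i v).trans
        (mul_le_mul_of_nonneg_right hcc'.le (apply_nonneg N v))⟩
    · push Not at hirr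
      obtain ⟨W, hW, hbot, htop⟩ := hirr
      obtain ⟨b, hcb, hbc'⟩ := exists_between hcc'
      have hpos : 0 < Module.finrank ℂ W := by
        have := Submodule.nontrivial_iff_ne_bot.2 hbot
        exact Module.finrank_pos
      have hlt : Module.finrank ℂ W < n := hn ▸ Submodule.finrank_lt htop
      have hsum := W.finrank_quotient_add_finrank
      exact .of_invariant hbc' hW (ih _ hlt hcb (hf.restrict hW) rfl)
        (ih _ (by omega) hcb (hf.mapQ hW) rfl)

end Family

/-! ### Products along walks in a finite graph. -/

section Path

variable {S V : Type*} [AddCommGroup V] [Module ℂ V]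

/-- The product `A (s (n-1)) * ⋯ * A (s 0)` along the path `s`. -/
def pathProd {X : Type*} [Monoid X] (A : S → X) (s : ℕ → S) : ℕ → X
  | 0 => 1
  | n + 1 => A (s n) * pathProd A s n

theorem pathProd_congr {X : Type*} [Monoid X] (A : S → X) {s t : ℕ → S} {n : ℕ}
    (h : ∀ k < n, s k = t k) : pathProd A s n = pathProd A t n := by
  induction n with
  | zero => rfl
  | succ n ih =>
    rw [pathProd, pathProd, h n n.lt_succ_self, ih fun k hk => h k (hk.trans n.lt_succ_self)]

open Classical in
/-- The endomorphism of `S → V` which moves the component at the source of the edge `e` to its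
target and applies `A` to it on the way. -/
noncomputable def edgeMap (A : S → Module.End ℂ V) {R : S → S → Prop}
    (e : {e : S × S // R e.1 e.2}) : Module.End ℂ (S → V) :=
  LinearMap.single ℂ (fun _ => V) e.1.2 ∘ₗ A e.1.1 ∘ₗ LinearMap.proj e.1.1

open Classical in
theorem edgeMap_list_prod (A : S → Module.End ℂ V) {R : S → S → Prop}
    (w : List {e : S × S // R e.1 e.2}) (hw : w ≠ []) :
    (w.map (edgeMap A)).prod = 0 ∨ ∃ s : ℕ → S, (∀ k < w.length, R (s k) (s (k + 1))) ∧
      (w.map (edgeMap A)).prod = LinearMap.single ℂ (fun _ => V) (s w.length) ∘ₗ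
        pathProd A s w.length ∘ₗ LinearMap.proj (s 0) := by
  induction w with
  | nil => exact absurd rfl hw
  | cons e w ih =>
    obtain ⟨⟨a, b⟩, hab⟩ := e
    rcases eq_or_ne w [] with rfl | hw'
    · refine Or.inr ⟨fun k => if k = 0 then a else b, ?_, ?_⟩
      · intro k hk
        obtain rfl : k = 0 := by simpa using hk
        simpa using hab
      · simp [edgeMap, pathProd]
    rcases ih hw' with h | ⟨s, hs, h⟩
    · left; simp [h]
    -- The head of the list acts last, so it prolongs the walk at its end, or annihilates the
    -- product if its source is elsewhere.
    by_cases ha : a = s w.length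
    · subst ha
      refine Or.inr ⟨Function.update s (w.length + 1) b, ?_, ?_⟩
      · intro k hk
        rw [List.length_cons] at hk
        rw [Function.update_of_ne (by omega)]
        rcases eq_or_ne k w.length with rfl | hk'
        · simpa using hab
        · rw [Function.update_of_ne (by omega)]
          exact hs k (by omega)
      · have hp : pathProd A (Function.update s (w.length + 1) b) w.length =
            pathProd A s w.length :=
          pathProd_congr A fun k hk => Function.update_of_ne (by omega) _ _
        rw [List.map_cons, List.prod_cons, h, List.length_cons, pathProd, hp,
          Function.update_self, Function.update_of_ne (by omega), Function.update_of_ne (by omega)]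
        ext1 x
        simp [edgeMap]
    · left
      rw [List.map_cons, List.prod_cons, h]
      ext1 x
      simp [edgeMap, Pi.single_eq_of_ne ha]

theorem eigenBound_edgeMap (A : S → Module.End ℂ V) {R : S → S → Prop} {c : ℝ} (hc : 0 ≤ c)
    (hper : ∀ n, 0 < n → ∀ s : ℕ → S, Function.Periodic s n → (∀ k, R (s k) (s (k + 1))) →
      ∀ z, (pathProd A s n).HasEigenvalue z → ‖z‖ ≤ c ^ n) :
    EigenBound (edgeMap A (R := R)) c := by
  classical
  intro w z hz
  obtain ⟨x, hx⟩ := hz.exists_hasEigenvector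
  have hxz := hx.apply_eq_smul
  rcases eq_or_ne z 0 with rfl | hz0
  · simpa using pow_nonneg hc _
  rcases eq_or_ne w [] with rfl | hw
  · have h1 : (1 : ℂ) • x = z • x := by simpa using hxz
    have : z = 1 := (smul_left_injective ℂ hx.2 h1).symm
    simp [this]
  have hn : 0 < w.length := List.length_pos_iff.2 hw
  rcases edgeMap_list_prod A w hw with h | ⟨s, hs, h⟩
  · rw [h, LinearMap.zero_apply] at hxz
    exact absurd hxz.symm (smul_ne_zero hz0 hx.2)
  set n := w.length
  rw [h] at hxz
  have hxz' : ∀ t, Pi.single (M := fun _ => V) (s n) (pathProd A s n (x (s 0))) t = z • x t :=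
    fun t => congrFun hxz t
  have hx0 : x (s 0) ≠ 0 := by
    intro h0
    refine hx.2 (funext fun t => ?_)
    have := hxz' t
    rw [h0, map_zero, Pi.single_zero, Pi.zero_apply] at this
    exact (smul_eq_zero.1 this.symm).resolve_left hz0
  -- The image is supported at `s n`, while the eigenvector is nonzero at `s 0`.
  have hclosed : s n = s 0 := by
    by_contra hne
    have := hxz' (s 0)
    rw [Pi.single_eq_of_ne (Ne.symm hne)] at this
    exact hx0 ((smul_eq_zero.1 this.symm).resolve_left hz0)
  have hmod : ∀ k < n, s (k % n) = s k := fun k hk => by rw [Nat.mod_eq_of_lt hk]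
  refine hper n hn (fun k => s (k % n)) (fun k => by simp) (fun k => ?_) z ?_
  · have hk := Nat.mod_lt k hn
    have hstep := hs _ hk
    rw [Nat.add_mod]
    rcases eq_or_ne (k % n + 1) n with he | he
    · rw [he, hclosed] at hstep
      rcases eq_or_ne n 1 with h1 | h1
      · simpa [h1, Nat.mod_one] using hstep
      · rw [Nat.mod_eq_of_lt (show 1 < n by omega), he, Nat.mod_self]
        exact hstep
    · rw [Nat.mod_eq_of_lt (show 1 < n by omega), Nat.mod_eq_of_lt (show k % n + 1 < n by omega)]
      exact hstep
  · rw [pathProd_congr A hmod]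
    refine Module.End.hasEigenvalue_of_hasEigenvector (x := x (s 0))
      ⟨Module.End.mem_eigenspace_iff.2 ?_, hx0⟩
    have := hxz' (s 0)
    rwa [hclosed, Pi.single_eq_same] at this

/-- The Berger–Wang theorem for products along the paths of a finite graph: the eigenvalues along
closed paths control the growth along all paths. -/
theorem exists_seminorm_pathProd_le [Finite S] [FiniteDimensional ℂ V] (A : S → Module.End ℂ V)
    {R : S → S → Prop} {c c' : ℝ} (hc : 0 < c) (hcc' : c < c')
    (hper : ∀ n, 0 < n → ∀ s : ℕ → S, Function.Periodic s n → (∀ k, R (s k) (s (k + 1))) →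
      ∀ z, (pathProd A s n).HasEigenvalue z → ‖z‖ ≤ c ^ n)
    (P Q : Seminorm ℂ V) (hQ : ∀ v, Q v = 0 → v = 0) :
    ∃ C, 0 < C ∧ ∀ (n : ℕ) (s : ℕ → S), (∀ k < n, R (s k) (s (k + 1))) →
      ∀ v, P (pathProd A s n v) ≤ C * c' ^ n * Q v := by
  classical
  have := Fintype.ofFinite S
  obtain ⟨N, hN, hNf⟩ := hasNormRate_of_eigenBound hc hcc' (eigenBound_edgeMap A hc.le hper)
  have hc' : 0 < c' := hc.trans hcc'
  let T : S → Seminorm ℂ V := fun t => N.comp (LinearMap.single ℂ (fun _ => V) t)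
  have hTdef : ∀ t v, T t v = N (Pi.single t v) := fun t v => rfl
  have hT : ∀ t v, T t v = 0 → v = 0 := fun t v h => by
    simpa using congrFun (hN _ h) t
  choose B hB0 hB using fun t => exists_seminorm_le_mul Q (T t) hQ
  choose D hD0 hD using fun t => exists_seminorm_le_mul (T t) P (hT t)
  have hBs : ∀ t, B t ≤ ∑ t, B t := fun t =>
    Finset.single_le_sum (f := B) (fun i _ => (hB0 i).le) (Finset.mem_univ t)
  have hDs : ∀ t, D t ≤ ∑ t, D t := fun t =>
    Finset.single_le_sum (f := D) (fun i _ => (hD0 i).le) (Finset.mem_univ t)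
  have hB' : 0 ≤ ∑ t, B t := Finset.sum_nonneg fun i _ => (hB0 i).le
  have hD' : 0 ≤ ∑ t, D t := Finset.sum_nonneg fun i _ => (hD0 i).le
  refine ⟨(∑ t, D t) * (∑ t, B t) + 1, by positivity, fun n s hs v => ?_⟩
  have hgrow : T (s n) (pathProd A s n v) ≤ c' ^ n * T (s 0) v := by
    induction n with
    | zero => simp [pathProd]
    | succ n ih =>
      have h1 := hNf ⟨(s n, s (n + 1)), hs n n.lt_succ_self⟩ (Pi.single (s n) (pathProd A s n v))
      have h2 : edgeMap A (R := R) ⟨(s n, s (n + 1)), hs n n.lt_succ_self⟩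
          (Pi.single (s n) (pathProd A s n v)) =
          Pi.single (s (n + 1)) (pathProd A s (n + 1) v) := by
        simp [edgeMap, pathProd]
      rw [h2, ← hTdef, ← hTdef] at h1
      refine h1.trans ?_
      rw [pow_succ', mul_assoc]
      exact mul_le_mul_of_nonneg_left (ih fun k hk => hs k (hk.trans n.lt_succ_self)) hc'.le
  have hQv : 0 ≤ Q v := apply_nonneg Q v
  calc P (pathProd A s n v) ≤ D (s n) * T (s n) (pathProd A s n v) := hD _ _
    _ ≤ (∑ t, D t) * T (s n) (pathProd A s n v) :=
        mul_le_mul_of_nonneg_right (hDs _) (apply_nonneg _ _)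
    _ ≤ (∑ t, D t) * (c' ^ n * T (s 0) v) := mul_le_mul_of_nonneg_left hgrow hD'
    _ ≤ (∑ t, D t) * (c' ^ n * ((∑ t, B t) * Q v)) := by
        gcongr
        exact (hB _ _).trans (mul_le_mul_of_nonneg_right (hBs _) hQv)
    _ = (∑ t, D t) * (∑ t, B t) * (c' ^ n * Q v) := by ring
    _ ≤ ((∑ t, D t) * (∑ t, B t) + 1) * (c' ^ n * Q v) := by
        gcongr
        linarith
    _ = _ := by ring

end Path

/-! ### Algebra of products along sequences. -/

section PathMap

variable {S X Y : Type*} [Monoid X] [Monoid Y]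

theorem map_pathProd (φ : X →* Y) (A : S → X) (s : ℕ → S) (n : ℕ) :
    φ (pathProd A s n) = pathProd (fun a => φ (A a)) s n := by
  induction n with
  | zero => exact map_one φ
  | succ n ih => rw [pathProd, pathProd, map_mul, ih]

theorem pathProd_comp {T : Type*} (A : T → X) (g : S → T) (s : ℕ → S) (n : ℕ) :
    pathProd (fun a => A (g a)) s n = pathProd A (fun k => g (s k)) n := by
  induction n with
  | zero => rfl
  | succ n ih => rw [pathProd, pathProd, ih]

theorem pathProd_add (A : S → X) (s : ℕ → S) (m n : ℕ) :
    pathProd A s (m + n) = pathProd A (fun k => s (m + k)) n * pathProd A s m := by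
  induction n with
  | zero => exact (one_mul _).symm
  | succ n ih => rw [← add_assoc, pathProd, ih, pathProd, mul_assoc]

theorem pathProd_mul_of_periodic (A : S → X) {s : ℕ → S} {n : ℕ} (hs : Function.Periodic s n)
    (k : ℕ) : pathProd A s (k * n) = pathProd A s n ^ k := by
  induction k with
  | zero => simp [pathProd]
  | succ k ih =>
    have h : (fun j => s (n + j)) = s := funext fun j => by rw [add_comm]; exact hs j
    rw [Nat.succ_mul, add_comm, pathProd_add, h, ih, ← pow_succ]

end PathMap

/-! ### Matrices, limits superior and the three radii. -/

variable {𝕂 : Type*} [RCLike 𝕂] {d r : ℕ}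

theorem matProd_eq_pathProd (M : Fin r → Matrix (Fin d) (Fin d) 𝕂) (β : ℕ → Fin r) (n : ℕ) :
    matProd M (fun k : Fin n => β k) = pathProd M β n := by
  induction n with
  | zero => simp [matProd, pathProd]
  | succ n ih =>
    rw [pathProd, ← ih, matProd, List.ofFn_succ_last]
    simp [matProd]

theorem rclike_map_mul (a b : 𝕂) :
    RCLike.map 𝕂 ℂ (a * b) = RCLike.map 𝕂 ℂ a * RCLike.map 𝕂 ℂ b := by
  apply Complex.ext <;> simp [RCLike.map_apply]

theorem norm_rclike_map (a : 𝕂) : ‖RCLike.map 𝕂 ℂ a‖ = ‖a‖ := by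
  rw [RCLike.map_apply]
  exact RCLike.norm_to_complex a

variable (𝕂 d) in
/-- The inclusion of the matrices over `𝕂` into the complex ones. -/
noncomputable def toComplexMatrix :
    Matrix (Fin d) (Fin d) 𝕂 →+* Matrix (Fin d) (Fin d) ℂ :=
  RingHom.mapMatrix
    { toFun := RCLike.map 𝕂 ℂ
      map_one' := by simp [RCLike.map_apply]
      map_mul' := rclike_map_mul
      map_zero' := map_zero _
      map_add' := map_add _ }

theorem toComplexMatrix_apply (X : Matrix (Fin d) (Fin d) 𝕂) :
    toComplexMatrix 𝕂 d X = X.map (RCLike.map 𝕂 ℂ) := rfl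

theorem specRad_pow_le (X : Matrix (Fin d) (Fin d) 𝕂) {k : ℕ} (hk : k ≠ 0) :
    specRad X ^ k ≤ specRad (X ^ k) := by
  have h : (X ^ k).map (RCLike.map 𝕂 ℂ) = X.map (RCLike.map 𝕂 ℂ) ^ k := by
    simp only [← toComplexMatrix_apply, map_pow]
  rw [specRad, specRad, h]
  exact spectrum.spectralRadius_pow_le _ k hk

open scoped Matrix.Norms.Operator in
theorem exists_specRad_le (N : AlgebraNorm 𝕂 (Matrix (Fin d) (Fin d) 𝕂)) :
    ∃ C, 0 < C ∧ ∀ X, specRad X ≤ ENNReal.ofReal C * ENNReal.ofReal (N X) := by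
  obtain ⟨C, hC, h⟩ := exists_seminorm_le_mul N.toSeminorm
    (normSeminorm 𝕂 (Matrix (Fin d) (Fin d) 𝕂)) (fun x hx => eq_zero_of_map_eq_zero N hx)
  set K : ℝ := ‖(1 : Matrix (Fin d) (Fin d) ℂ)‖ with hK
  have hK0 : 0 ≤ K := norm_nonneg _
  refine ⟨C * K + 1, by positivity, fun X => iSup₂_le fun z hz => ?_⟩
  have hX : ‖X.map (RCLike.map 𝕂 ℂ)‖ = ‖X‖ := by
    rw [Matrix.linfty_opNorm_def, Matrix.linfty_opNorm_def]
    congr! 4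
    exact NNReal.eq (norm_rclike_map _)
  have h1 := spectrum.norm_le_norm_mul_of_mem hz
  have h2 : ‖X‖ ≤ C * N X := h X
  have h3 : 0 ≤ N X := apply_nonneg N X
  rw [← ENNReal.ofReal_mul (by positivity)]
  refine (ofReal_norm z).symm.trans_le (ENNReal.ofReal_le_ofReal ?_)
  rw [hX, ← hK] at h1
  nlinarith [mul_le_mul_of_nonneg_right h2 hK0]

theorem tendsto_ofReal_rpow_one_div {C : ℝ} (hC : 0 < C) :
    Tendsto (fun n : ℕ => ENNReal.ofReal C ^ (1 / (n : ℝ))) atTop (nhds 1) := by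
  have h : Tendsto (fun n : ℕ => C ^ (1 / (n : ℝ))) atTop (nhds (C ^ (0 : ℝ))) :=
    (Real.continuousAt_const_rpow hC.ne').tendsto.comp tendsto_one_div_atTop_nhds_zero_nat
  rw [Real.rpow_zero] at h
  have h' := ENNReal.tendsto_ofReal h
  rw [ENNReal.ofReal_one] at h'
  exact h'.congr fun n => (ENNReal.ofReal_rpow_of_pos hC).symm

theorem limsup_le_of_le_rpow_mul {u v : ℕ → ℝ≥0∞} {C : ℝ} (hC : 0 < C)
    (h : ∀ᶠ n : ℕ in atTop, u n ≤ ENNReal.ofReal C ^ (1 / (n : ℝ)) * v n) :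
    limsup u atTop ≤ limsup v atTop := by
  have h1 := (tendsto_ofReal_rpow_one_div hC).limsup_eq
  calc limsup u atTop
      ≤ limsup ((fun n : ℕ => ENNReal.ofReal C ^ (1 / (n : ℝ))) * v) atTop := limsup_le_limsup h
    _ ≤ limsup (fun n : ℕ => ENNReal.ofReal C ^ (1 / (n : ℝ))) atTop * limsup v atTop :=
        ENNReal.limsup_mul_le' (Or.inl (by rw [h1]; exact one_ne_zero))
          (Or.inl (by rw [h1]; exact ENNReal.one_ne_top))
    _ = limsup v atTop := by rw [h1, one_mul]

theorem genRad_le_jointRad (N : AlgebraNorm 𝕂 (Matrix (Fin d) (Fin d) 𝕂))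
    (M : Fin r → Matrix (Fin d) (Fin d) 𝕂) (l : ℕ) (pm pp : Fin r → ℝ) :
    genRad M l pm pp ≤ jointRad N M l pm pp := by
  obtain ⟨C, hC, h⟩ := exists_specRad_le N
  refine limsup_le_of_le_rpow_mul hC (Eventually.of_forall fun n => iSup₂_le fun α hα => ?_)
  calc specRad (matProd M α) ^ (1 / (n : ℝ))
      ≤ (ENNReal.ofReal C * ENNReal.ofReal (N (matProd M α))) ^ (1 / (n : ℝ)) :=
        ENNReal.rpow_le_rpow (h _) (by positivity)
    _ = ENNReal.ofReal C ^ (1 / (n : ℝ)) * ENNReal.ofReal (N (matProd M α)) ^ (1 / (n : ℝ)) :=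
        ENNReal.mul_rpow_of_nonneg _ _ (by positivity)
    _ ≤ _ := by
        gcongr
        exact le_iSup₂ (f := fun (α : Fin n → Fin r) (_ : α ∈ admissible l pm pp n) =>
          ENNReal.ofReal (N (matProd M α)) ^ (1 / (n : ℝ))) α hα

theorem perRad_le_genRad (M : Fin r → Matrix (Fin d) (Fin d) 𝕂) (l : ℕ) (pm pp : Fin r → ℝ) :
    perRad M l pm pp ≤ genRad M l pm pp :=
  limsup_le_limsup (Eventually.of_forall fun _ => biSup_mono fun _ hα => hα.1)

theorem jointRad_ne_top (N : AlgebraNorm 𝕂 (Matrix (Fin d) (Fin d) 𝕂))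
    (M : Fin r → Matrix (Fin d) (Fin d) 𝕂) (l : ℕ) (pm pp : Fin r → ℝ) :
    jointRad N M l pm pp ≠ ∞ := by
  set K : ℝ := ∑ i, N (M i) with hKdef
  have hK : ∀ i, N (M i) ≤ K := fun i =>
    Finset.single_le_sum (f := fun i => N (M i)) (fun i _ => apply_nonneg N _) (Finset.mem_univ i)
  have hK0 : 0 ≤ K := Finset.sum_nonneg fun i _ => apply_nonneg N _
  -- Length zero is excluded, as `N 1` may exceed `1`.
  have hprod : ∀ n (β : ℕ → Fin r), N (pathProd M β (n + 1)) ≤ K ^ (n + 1) := by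
    intro n β
    induction n with
    | zero => simpa [pathProd] using hK (β 0)
    | succ n ih =>
      rw [pathProd, pow_succ']
      exact (map_mul_le_mul N _ _).trans (mul_le_mul (hK _) ih (apply_nonneg N _) hK0)
  refine ne_top_of_le_ne_top (ENNReal.ofReal_ne_top (r := K))
    (limsup_le_of_le (h := (eventually_ge_atTop 1).mono fun n hn => iSup₂_le ?_))
  rintro α ⟨β, -, hβ⟩
  obtain rfl : (fun k : Fin n => β k) = α := funext hβ
  obtain ⟨m, rfl⟩ := Nat.exists_eq_add_of_le' hn
  rw [matProd_eq_pathProd]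
  refine (ENNReal.rpow_le_rpow (ENNReal.ofReal_le_ofReal (hprod m β)) (by positivity)).trans ?_
  rw [ENNReal.ofReal_pow hK0, one_div, ENNReal.pow_rpow_inv_natCast (by omega)]

/-- Repeating a periodic sequence shows that its spectral radius is accounted for in the limit
superior. -/
theorem specRad_le_perRad_pow (M : Fin r → Matrix (Fin d) (Fin d) 𝕂) {l : ℕ} {pm pp : Fin r → ℝ}
    {n : ℕ} (hn : 0 < n) {β : ℕ → Fin r} (hβ : β ∈ seqs l pm pp) (hper : Function.Periodic β n) :
    specRad (pathProd M β n) ≤ perRad M l pm pp ^ n := by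
  have hn' : (n : ℝ) ≠ 0 := by positivity
  have hle : specRad (pathProd M β n) ^ (1 / (n : ℝ)) ≤ perRad M l pm pp := by
    refine le_limsup_of_frequently_le (frequently_atTop.2 fun m => ⟨(m + 1) * n, by nlinarith, ?_⟩)
    have hmem : (fun k : Fin ((m + 1) * n) => β k) ∈ perAdmissible l pm pp ((m + 1) * n) :=
      ⟨⟨β, hβ, fun _ => rfl⟩, β, hβ, by
        simpa using hper.nat_mul (m + 1), fun _ => rfl⟩
    refine le_iSup₂_of_le _ hmem ?_
    rw [matProd_eq_pathProd, pathProd_mul_of_periodic M hper]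
    refine le_trans (le_of_eq ?_)
      (ENNReal.rpow_le_rpow (specRad_pow_le _ m.succ_ne_zero) (by positivity))
    rw [← ENNReal.rpow_natCast, ← ENNReal.rpow_mul]
    congr 1
    push_cast
    field_simp
  calc specRad (pathProd M β n) = (specRad (pathProd M β n) ^ (1 / (n : ℝ))) ^ n := by
        rw [one_div, ENNReal.rpow_inv_natCast_pow hn.ne']
    _ ≤ _ := by gcongr

/-- Overlaps force the first symbols of the next `l` vertices to spell out the current block. -/
theorem mem_seqs_of_path {l : ℕ} (hl : 1 ≤ l) {pm pp : Fin r → ℝ} {s : ℕ → blocks l pm pp}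
    (hs : ∀ k, ∀ i j : Fin l, (i : ℕ) = j + 1 → (s k).1 i = (s (k + 1)).1 j) :
    (fun k => (s k).1 ⟨0, hl⟩) ∈ seqs l pm pp := by
  have key : ∀ (j : ℕ) (hj : j < l) (m : ℕ), (s (m + j)).1 ⟨0, hl⟩ = (s m).1 ⟨j, hj⟩ := by
    intro j
    induction j with
    | zero => intro _ m; rfl
    | succ j ih =>
      intro hj m
      rw [hs m ⟨j + 1, hj⟩ ⟨j, by omega⟩ rfl, ← ih (by omega) (m + 1), add_right_comm,
        add_assoc]
  intro m
  have : (fun k : Fin l => (s (m + k)).1 ⟨0, hl⟩) = (s m).1 := funext fun k => key k k.2 m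
  simpa only [this] using (s m).2

open scoped Matrix.Norms.Elementwise in
theorem exists_norm_pathProd_le (N : AlgebraNorm 𝕂 (Matrix (Fin d) (Fin d) 𝕂))
    (M : Fin r → Matrix (Fin d) (Fin d) 𝕂) {l : ℕ} (hl : 1 ≤ l) {pm pp : Fin r → ℝ}
    {c c' : ℝ} (hc : 0 < c) (hcc' : c < c') (hper : perRad M l pm pp ≤ ENNReal.ofReal c) :
    ∃ C, 0 < C ∧ ∀ β ∈ seqs l pm pp, ∀ n, N (pathProd M β n) ≤ C * c' ^ n := by
  have hc' : 0 < c' := hc.trans hcc'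
  let Φ : Matrix (Fin d) (Fin d) 𝕂 →* Module.End ℂ (Fin d → ℂ) :=
    (Matrix.toLinAlgEquiv' : Matrix (Fin d) (Fin d) ℂ ≃ₐ[ℂ] _).toAlgHom.toRingHom.toMonoidHom.comp
      (toComplexMatrix 𝕂 d : Matrix (Fin d) (Fin d) 𝕂 →* Matrix (Fin d) (Fin d) ℂ)
  have hΦ : ∀ X, Φ X = Matrix.toLinAlgEquiv' (X.map (RCLike.map 𝕂 ℂ)) := fun X => rfl
  let A : blocks l pm pp → Module.End ℂ (Fin d → ℂ) := fun s => Φ (M (s.1 ⟨0, hl⟩))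
  have hA : ∀ s n, pathProd A s n = Φ (pathProd M (fun k => (s k).1 ⟨0, hl⟩) n) := by
    intro s n
    rw [map_pathProd]
    exact pathProd_comp (fun a => Φ (M a)) (fun s : blocks l pm pp => s.1 ⟨0, hl⟩) s n
  obtain ⟨C, hC, hbound⟩ := exists_seminorm_pathProd_le A
    (R := fun s t => ∀ i j : Fin l, (i : ℕ) = j + 1 → s.1 i = t.1 j) hc hcc' (by
      intro n hn s hs hR z hz
      rw [hA, Module.End.hasEigenvalue_iff_mem_spectrum, hΦ, AlgEquiv.spectrum_eq] at hz
      have h1 := specRad_le_perRad_pow M hn (mem_seqs_of_path hl hR)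
        (fun k => by simp only [hs k])
      have h2 : (‖z‖₊ : ℝ≥0∞) ≤ ENNReal.ofReal (c ^ n) := by
        rw [ENNReal.ofReal_pow hc.le]
        exact (le_iSup₂_of_le z hz le_rfl).trans (h1.trans (by gcongr))
      exact (ENNReal.ofReal_le_ofReal_iff (by positivity)).1
        ((ofReal_norm z).trans_le h2))
    (normSeminorm ℂ (Fin d → ℂ)) (normSeminorm ℂ (Fin d → ℂ)) (fun v hv => norm_eq_zero.1 hv)
  obtain ⟨K, hK, hNK⟩ := exists_seminorm_le_mul
    (normSeminorm 𝕂 (Matrix (Fin d) (Fin d) 𝕂)) N.toSeminorm (fun x hx => norm_eq_zero.1 hx)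
  refine ⟨K * C, by positivity, fun β hβ n => ?_⟩
  have hentry : ‖pathProd M β n‖ ≤ C * c' ^ n := by
    rw [Matrix.norm_le_iff (by positivity)]
    intro i j
    -- The walk of successive windows of `β`; a basis vector picks out column `j`.
    have h := hbound n (fun k => ⟨_, hβ k⟩) (fun k _ i j hij => by
      simp only [hij]; congr 1; omega) (Pi.single j 1)
    rw [hA, hΦ] at h
    simp only [coe_normSeminorm, Pi.norm_single, norm_one, mul_one] at h
    refine le_trans ?_ h
    refine le_trans (le_of_eq ?_) (norm_le_pi_norm _ i)
    simp
  calc N (pathProd M β n) ≤ K * ‖pathProd M β n‖ := hNK _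
    _ ≤ K * (C * c' ^ n) := by gcongr
    _ = _ := by ring

theorem jointRad_le_perRad (N : AlgebraNorm 𝕂 (Matrix (Fin d) (Fin d) 𝕂))
    (M : Fin r → Matrix (Fin d) (Fin d) 𝕂) {l : ℕ} (hl : 1 ≤ l) (pm pp : Fin r → ℝ) :
    jointRad N M l pm pp ≤ perRad M l pm pp := by
  refine le_of_forall_gt_imp_ge_of_dense fun b hb => ?_
  obtain ⟨c', hc', hc'b⟩ := ENNReal.lt_iff_exists_nnreal_btwn.1 hb
  -- Two intermediate rates: `c` is positive even if `perRad` is `0`, and Berger–Wang needs the gap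
  -- `c < c'`.
  obtain ⟨c, hc, hcc'⟩ := ENNReal.lt_iff_exists_nnreal_btwn.1 hc'
  refine le_trans ?_ hc'b.le
  have hc0 : (0 : ℝ) < c := by exact_mod_cast pos_of_gt hc
  have hcc : (c : ℝ) < c' := by exact_mod_cast hcc'
  obtain ⟨C, hC, h⟩ := exists_norm_pathProd_le N M hl hc0 hcc
    (pm := pm) (pp := pp) (by simpa using hc.le)
  have hlim : limsup (fun _ : ℕ => (c' : ℝ≥0∞)) atTop = c' := limsup_const _
  rw [← hlim]
  refine limsup_le_of_le_rpow_mul hC ((eventually_ge_atTop 1).mono fun n hn => iSup₂_le ?_)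
  rintro α ⟨β, hβ, hβα⟩
  obtain rfl : (fun k : Fin n => β k) = α := funext hβα
  rw [matProd_eq_pathProd]
  refine (ENNReal.rpow_le_rpow (ENNReal.ofReal_le_ofReal (h β hβ n)) (by positivity)).trans ?_
  rw [ENNReal.ofReal_mul hC.le, ENNReal.mul_rpow_of_nonneg _ _ (by positivity),
    ENNReal.ofReal_pow c'.coe_nonneg, one_div, ENNReal.pow_rpow_inv_natCast (by omega),
    ENNReal.ofReal_coe_nnreal]

end ConstrainedJSR

theorem theorem2 {𝕂 : Type*} [RCLike 𝕂] {d r : ℕ}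
    (N : AlgebraNorm 𝕂 (Matrix (Fin d) (Fin d) 𝕂))
    (M : Fin r → Matrix (Fin d) (Fin d) 𝕂)
    (l : ℕ) (hl : 1 ≤ l)
    (p pm pp : Fin r → ℝ)
    (hp_pos : ∀ i, 0 < p i) (hp_sum : ∑ i, p i = 1)
    (hpm_nonneg : ∀ i, 0 ≤ pm i) (hpm_lt : ∀ i, pm i < p i)
    (hpp_lt : ∀ i, p i < pp i) (hpp_le : ∀ i, pp i ≤ 1) :
    ConstrainedJSR.jointRad N M l pm pp ≠ ∞ ∧
      ConstrainedJSR.perRad M l pm pp = ConstrainedJSR.jointRad N M l pm pp ∧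
      ConstrainedJSR.genRad M l pm pp = ConstrainedJSR.jointRad N M l pm pp := by
  have hpg := ConstrainedJSR.perRad_le_genRad M l pm pp
  have hgj := ConstrainedJSR.genRad_le_jointRad N M l pm pp
  have hjp := ConstrainedJSR.jointRad_le_perRad N M hl pm pp
  exact ⟨ConstrainedJSR.jointRad_ne_top N M l pm pp, le_antisymm (hpg.trans hgj) hjp,
    le_antisymm hgj (hjp.trans hpg)⟩
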